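/- Let $k$ be an algebraically closed field (of any characteristic), let $R=k[X_0,X_1,X_2]$, and let $I\subset R$ be a homogeneous ideal of codimension (height) $2$ generated by a minimal generating set of homogeneous polynomials $\mathbf f=(f_0,f_1,f_2,f_3)$ of the same degree $d$. Let $J(\mathbf f)=(\partial f_i/\partial X_j)$ be the $4\times 3$ Jacobian matrix, let $I_3(J(\mathbf f))$ be the ideal generated by its $3\times 3$ minors, assume $I_3(J(\mathbf f))\neq 0$, and let $F$ be the greatest common divisor of these minors. Let $\Gamma\subset\mathbb P^2_k\times\mathbb P^3_k$ be the closure of the graph of the rational map $\phi=(f_0:f_1:f_2:f_3):\mathbb P^2_k\dashrightarrow\mathbb P^3_k$; it is defined by the Rees algebra $\mathcal R_I=R[T_0,\dots,T_3]/\mathfrak P$, where $\mathfrak P$ is the kernel of $R[T_0,\dots,T_3]\to R[t]$, $T_i\mapsto f_it$. Let $\pi:\Gamma\to\mathbb P^3_k$ be the second projection. For a closed point $y=(p_0:\cdots:p_3)$ its fiber is $$\pi^{-1}(y)=\operatorname{Proj}(\mathcal R_I\otimes_{k[T_0,\dots,T_3]}k(y))=\operatorname{Proj}(R/J_y)\subset\mathbb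 P^2_k,\qquad J_y=\{P(X,p_0,\dots,p_3)\mid P\in\mathfrak P\}.$$ Let $\mathcal Y_1$ be the set of closed points $y\in\mathbb P^3_k$ with $\dim\pi^{-1}(y)=1$. Then $\mathcal Y_1$ is finite. For every $y\in\mathcal Y_1$ the unmixed part of $\pi^{-1}(y)$ of maximal dimension (that is, the intersection of the primary components of $J_y$ at the minimal primes of $J_y$ whose height equals that of $J_y$) is defined by one homogeneous polynomial $h_y\in R$. If $h_y=h_{y,1}^{e_{y,1}}\cdots h_{y,r_y}^{e_{y,r_y}}$ is an irreducible factorization of $h_y$ in $R$ (up to a nonzero constant, with pairwise non-associated irreducible $h_{y,i}$ and $e_{y,i}\ge 1$), then $$\sum_{y\in\mathcal Y_1}\deg(h_y)\;\le\;\sum_{y\in\mathcal Y_1}\sum_{i=1}^{r_y}(2e_{y,i}-1)\deg(h_{y,i})\;\le\;\deg(F)\;\le\;3(d-1).$$ -/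

import Mathlib

open scoped LinearAlgebra.Projectivization

noncomputable section

namespace ProjectiveRationalMap

open MvPolynomial

attribute [local instance] MvPolynomial.gradedAlgebra

/-- The ideal `I_s(M)` is generated by the set `minors s M` of all `s × s` minors of `M`
(choose `s` rows and `s` columns, in increasing order, and take the determinant). -/
def minors {A : Type*} [CommRing A] {a b : ℕ} (s : ℕ) (M : Matrix (Fin a) (Fin b) A) : Set A :=
  {x | ∃ (r : Fin s ↪o Fin a) (c : Fin s ↪o Fin b), x = (M.submatrix r c).det}

/-- The determinantal ideal `I_s(M)`. -/
def minorsIdeal {A : Type*} [CommRing A] {a b : ℕ} (s : ℕ) (M : Matrix (Fin a) (Fin b) A) :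
    Ideal A :=
  Ideal.span (minors s M)

/-- `F` is a greatest common divisor of the elements of the set `s`. -/
def IsGCDOf {A : Type*} [CommRing A] (F : A) (s : Set A) : Prop :=
  (∀ x ∈ s, F ∣ x) ∧ ∀ G : A, (∀ x ∈ s, G ∣ x) → G ∣ F

/-- `h = h₁ ^ e₁ ⋯ h_r ^ e_r` (up to a unit) is a factorization into powers, with positive
exponents, of pairwise non-associated irreducible elements. -/
structure IsIrreducibleFactorization {A : Type*} [CommRing A] (h : A) {r : ℕ}
    (g : Fin r → A) (e : Fin r → ℕ) : Prop where
  irreducible : ∀ i, Irreducible (g i)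
  not_associated : ∀ i j, i ≠ j → ¬ Associated (g i) (g j)
  exponent_pos : ∀ i, 0 < e i
  factorization : Associated h (∏ i, g i ^ e i)

/-- The unmixed part (of maximal dimension) of an ideal `J`: the intersection of the primary
components of `J` at those minimal primes `q` of `J` whose height is the height of `J`.
The primary component at a minimal prime `q` is the contraction of `J A_q` to `A`. -/
def unmixedPart {A : Type*} [CommRing A] (J : Ideal A) : Ideal A :=
  ⨅ (q : PrimeSpectrum A) (_ : q.asIdeal ∈ J.minimalPrimes ∧ q.asIdeal.height = J.height),
    (J.map (algebraMap A (Localization.AtPrime q.asIdeal))).comap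
      (algebraMap A (Localization.AtPrime q.asIdeal))

variable {k : Type*} [Field k] {m n : ℕ}

/-- The base ideal, generated by the polynomials `f`. -/
def baseIdeal (f : Fin n → MvPolynomial (Fin m) k) : Ideal (MvPolynomial (Fin m) k) :=
  Ideal.span (Set.range f)

/-- The Jacobian matrix: the row of `f i` consists of its partial derivatives. -/
def jacobian (f : Fin n → MvPolynomial (Fin m) k) :
    Matrix (Fin n) (Fin m) (MvPolynomial (Fin m) k) :=
  Matrix.of fun i j => pderiv j (f i)

/-- With `R = k[X]` and `I = (f)`, the surjection `R[T] → Rees_R(I) = ⨁ Iˢ tˢ`, `T i ↦ f i * t`. -/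
def reesMap (f : Fin n → MvPolynomial (Fin m) k) :
    MvPolynomial (Fin n) (MvPolynomial (Fin m) k) →ₐ[MvPolynomial (Fin m) k]
      reesAlgebra (baseIdeal f) :=
  aeval fun i => ⟨Polynomial.monomial 1 (f i), reesAlgebra.monomial_mem.2 (by
    rw [pow_one]; exact Ideal.subset_span (Set.mem_range_self i))⟩

/-- The ideal of `R[T] = k[X][T]` that defines the closure `Γ` of the graph of
`(f₀ : f₁ : ⋯)` (the blow-up of the base locus): `R[T] / reesIdeal f = Rees_R(I)`. -/
def reesIdeal (f : Fin n → MvPolynomial (Fin m) k) :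
    Ideal (MvPolynomial (Fin n) (MvPolynomial (Fin m) k)) :=
  RingHom.ker (reesMap f)

/-- The ideal `{P(X, p) | P ∈ reesIdeal f}` of `R = k[X]`. With `B = k[T] → k`, `T i ↦ p i`, it
is the ideal for which `Rees_R(I) ⊗_B k = R / fiberIdeal f p`. It is homogeneous, and it does not
change when `p` is multiplied by a nonzero scalar. -/
def fiberIdeal (f : Fin n → MvPolynomial (Fin m) k) (p : Fin n → k) :
    Ideal (MvPolynomial (Fin m) k) :=
  (reesIdeal f).map (eval fun i => (C (p i) : MvPolynomial (Fin m) k))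

/-- The (underlying closed subset of `Proj k[X]` of the) fiber at a point `y` of the projection
of `Γ` to the target, that is, `Proj (Rees_R(I) ⊗_B k(y))`. -/
def fiber (f : Fin n → MvPolynomial (Fin m) k) (y : ℙ k (Fin n → k)) :
    Set (ProjectiveSpectrum (homogeneousSubmodule (Fin m) k)) :=
  ProjectiveSpectrum.zeroLocus (homogeneousSubmodule (Fin m) k) (fiberIdeal f y.rep)

/-- The points of the target whose fiber has dimension `l`. -/
def pointsWithFiberDim (f : Fin n → MvPolynomial (Fin m) k) (l : ℕ) : Set (ℙ k (Fin n → k)) :=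
  {y | topologicalKrullDim (fiber f y) = l}

/-- `h` is a defining equation of the unmixed part of the fiber at `y`. -/
def IsUnmixedFiberEquation (f : Fin n → MvPolynomial (Fin m) k) (y : ℙ k (Fin n → k))
    (h : MvPolynomial (Fin m) k) : Prop :=
  (∃ a, h.IsHomogeneous a) ∧ Ideal.span {h} = unmixedPart (fiberIdeal f y.rep)

end ProjectiveRationalMap

end

open ProjectiveRationalMap

open ProjectiveRationalMap

/-! For a point p of the target, let H be the gcd of the 2 × 2 minors `p i * f j - p j * f i`.
Modulo H the vector f is p * u for a single polynomial u. Since I has height 2, the `f i` have no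
common prime factor, so u is coprime to H. Substituting f = p * u in the Rees equations and
cancelling powers of u shows that H divides the whole fiber ideal (`dvd_of_mem_fiberIdeal`). Hence H
is its gcd, and when the fiber is a curve, H generates its unmixed part.

If g ^ e divides H, differentiating f = p * u + g ^ e * a makes the Jacobian a rank one matrix plus
g ^ (e - 1) times a matrix that has rank at most one modulo g. So g ^ (2 * e - 1) divides every 3 ×
3 minor, hence F, in any characteristic (`pow_dvd_of_mem_minors_jacobian`).

A prime cannot divide H for two different points (`mk_eq_mk_of_prime_dvd`). The powers found over
all points and all factors are therefore pairwise coprime, and their product divides F. Comparing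
degrees gives the bound; finiteness follows because F has finitely many prime factors. -/

namespace ProjectiveRationalMap

/-! ### Greatest common divisors and the unmixed part in a UFD -/

section UniqueFactorization

variable {A : Type*} [CommRing A] [IsDomain A] [UniqueFactorizationMonoid A]

/-- If no prime factor of `h` divides every `s` with `h ∣ s * x`, then `h ∣ x`. -/
theorem dvd_of_forall_prime_exists_dvd_mul {h x : A} (h0 : h ≠ 0)
    (H : ∀ g, Prime g → g ∣ h → ∃ s, ¬ g ∣ s ∧ h ∣ s * x) : h ∣ x := by
  obtain ⟨a, b, c, hab, rfl, rfl⟩ := UniqueFactorizationMonoid.exists_reduced_factors h h0 x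
  have hc : c ≠ 0 := left_ne_zero_of_mul h0
  have ha : a ≠ 0 := right_ne_zero_of_mul h0
  suffices IsUnit a from mul_dvd_mul_left c this.dvd
  by_contra hu
  obtain ⟨g, hg, hga⟩ := WfDvdMonoid.exists_irreducible_factor hu ha
  obtain ⟨s, hs, t, ht⟩ := H g hg.prime (hga.mul_left c)
  refine hs (hga.trans ((hab.dvd_of_dvd_mul_right (z := b)) ⟨t, ?_⟩))
  exact mul_left_cancel₀ hc (by linear_combination ht)

omit [UniqueFactorizationMonoid A] in
theorem eq_span_singleton_of_prime_mem_of_height_le_one {q : Ideal A} [q.IsPrime]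
    (hq : q.height ≤ 1) {g : A} (hg : Prime g) (hgq : g ∈ q) : q = Ideal.span {g} := by
  have hle : Ideal.span {g} ≤ q := by rwa [Ideal.span_singleton_le_iff_mem]
  have : (Ideal.span {g}).IsPrime := (Ideal.span_singleton_prime hg.ne_zero).2 hg
  refine (hle.lt_or_eq.resolve_left fun hlt => ?_).symm
  have h1 := Ideal.height_add_one_le_of_lt_of_isPrime hlt
  have h0 : (Ideal.span {g}).height ≠ 0 := by
    rw [Ne, Ideal.height_eq_zero_iff_eq_bot, Ideal.span_singleton_eq_bot]
    exact hg.ne_zero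
  have h2 : 1 ≤ (Ideal.span {g}).height := Order.one_le_iff_ne_zero.2 h0
  have h3 : (1 : ℕ∞) + 1 ≤ 1 := (add_le_add_left h2 1).trans (h1.trans hq)
  exact absurd h3 (by decide)

/-- The ideal has height 1, so the primes in the intersection are generated by primes g. Prime by
prime: an element of the component at (g) lies in J up to a factor prime to g. Conversely, since h *
g cannot divide all of J, some h * x' in J has x' outside (g), which puts h in that component. -/
theorem unmixedPart_eq_span_of_isGCDOf [IsNoetherianRing A] {J : Ideal A} (hJ : J ≠ ⊥) {h : A}
    (hh : IsGCDOf h (J : Set A)) (hu : ¬ IsUnit h) : unmixedPart J = Ideal.span {h} := by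
  have hJh : J ≤ Ideal.span {h} := fun x hx => Ideal.mem_span_singleton.2 (hh.1 x hx)
  have h0 : h ≠ 0 := by
    rintro rfl
    exact hJ (by simpa using hJh)
  have hJ1 : J.height = 1 := by
    refine le_antisymm ((Ideal.height_mono hJh).trans (Ideal.height_span_singleton_le_one hu)) ?_
    rwa [Order.one_le_iff_ne_zero, Ne, Ideal.height_eq_zero_iff_eq_bot]
  apply le_antisymm
  · intro x hx
    rw [Ideal.mem_span_singleton]
    refine dvd_of_forall_prime_exists_dvd_mul h0 fun g hg hgh => ?_
    have hq : (Ideal.span {g}).IsPrime := (Ideal.span_singleton_prime hg.ne_zero).2 hg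
    have hJg : J ≤ Ideal.span {g} :=
      hJh.trans (Ideal.span_singleton_le_span_singleton.2 hgh)
    have hg1 : (Ideal.span {g}).height ≤ J.height := by
      rw [hJ1]; exact Ideal.height_span_singleton_le_one hg.not_isUnit
    have hqmin : Ideal.span {g} ∈ J.minimalPrimes := Ideal.mem_minimalPrimes_of_height_le hJg hg1
    simp only [unmixedPart, Submodule.mem_iInf] at hx
    have hx' := hx ⟨Ideal.span {g}, hq⟩ ⟨hqmin, le_antisymm hg1 (Ideal.height_mono hJg)⟩
    rw [Ideal.mem_comap, IsLocalization.algebraMap_mem_map_algebraMap_iff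
      (Ideal.span {g}).primeCompl] at hx'
    obtain ⟨s, hs, hsx⟩ := hx'
    exact ⟨s, fun hgs => hs (Ideal.mem_span_singleton.2 hgs), hh.1 _ hsx⟩
  · rw [Ideal.span_singleton_le_iff_mem]
    simp only [unmixedPart, Submodule.mem_iInf]
    rintro ⟨q, hq⟩ ⟨hqmin, hqh⟩
    have hqJ : J ≤ q := hqmin.1.2
    have hq0 : q ≠ ⊥ := fun h => hJ (by rwa [h, le_bot_iff] at hqJ)
    obtain ⟨g, hgq, hg⟩ := hq.exists_mem_prime_of_ne_bot hq0
    have hqg := eq_span_singleton_of_prime_mem_of_height_le_one (by simpa [hJ1] using hqh.le) hg hgq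
    have : ∃ x ∈ J, ¬ h * g ∣ x := by
      by_contra! hall
      obtain ⟨t, ht⟩ := hh.2 _ hall
      exact hg.not_isUnit (.of_mul_eq_one t (mul_left_cancel₀ h0 (by linear_combination -ht)))
    obtain ⟨x, hx, hgx⟩ := this
    obtain ⟨x', rfl⟩ := hh.1 x hx
    rw [Ideal.mem_comap, IsLocalization.algebraMap_mem_map_algebraMap_iff q.primeCompl]
    refine ⟨x', fun hx' => hgx (mul_dvd_mul_left h ?_), by rwa [mul_comm]⟩
    rw [← Ideal.mem_span_singleton, ← hqg]
    exact hx'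

omit [IsDomain A] in
/-- Finite families have greatest common divisors. -/
theorem exists_isGCDOf_range {ι : Type*} [Finite ι] (v : ι → A) :
    ∃ h, IsGCDOf h (Set.range v) := by
  classical
  have := Fintype.ofFinite ι
  let _ := UniqueFactorizationMonoid.strongNormalizationMonoid (α := A)
  let _ := UniqueFactorizationMonoid.toNormalizedGCDMonoid A
  refine ⟨Finset.univ.gcd v, ?_, fun G hG => Finset.dvd_gcd fun i _ => hG _ ⟨i, rfl⟩⟩
  rintro _ ⟨i, rfl⟩
  exact Finset.gcd_dvd (Finset.mem_univ i)

omit [IsDomain A] [UniqueFactorizationMonoid A] in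
theorem not_forall_prime_dvd_of_one_lt_height_span [IsNoetherianRing A] {ι : Type*} {v : ι → A}
    (hv : 1 < (Ideal.span (Set.range v)).height) {g : A} (hg : Prime g) : ¬ ∀ i, g ∣ v i := by
  intro h
  refine absurd hv (not_lt.2 (le_trans (Ideal.height_mono ?_)
    (Ideal.height_span_singleton_le_one hg.not_isUnit)))
  rw [Ideal.span_le]
  rintro _ ⟨i, rfl⟩
  exact Ideal.mem_span_singleton.2 (h i)

end UniqueFactorization

open MvPolynomial

/-! ### Factors of homogeneous polynomials -/

section Homogeneous

variable {σ k : Type*} [CommRing k]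

/-- The substitution `X i ↦ X i * t`. -/
noncomputable def gradingHom (σ k : Type*) [CommRing k] :
    MvPolynomial σ k →ₐ[k] Polynomial (MvPolynomial σ k) :=
  aeval fun i => Polynomial.C (X i) * Polynomial.X

theorem gradingHom_monomial (s : σ →₀ ℕ) (a : k) :
    gradingHom σ k (monomial s a) = Polynomial.monomial s.degree (monomial s a) := by
  induction s using Finsupp.induction with
  | zero =>
    simp [gradingHom, IsScalarTower.algebraMap_apply k (MvPolynomial σ k) (Polynomial _),
      ← C_apply, algebraMap_eq]
  | single_add i n s _ _ ih =>
    rw [monomial_single_add, map_mul, ih, map_add, Finsupp.degree_single]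
    simp [gradingHom, mul_pow, ← Polynomial.C_mul_X_pow_eq_monomial]
    ring

theorem coeff_gradingHom (p : MvPolynomial σ k) (n : ℕ) :
    (gradingHom σ k p).coeff n = homogeneousComponent n p := by
  induction p using MvPolynomial.induction_on' with
  | monomial s a =>
    rw [gradingHom_monomial, Polynomial.coeff_monomial,
      homogeneousComponent_of_mem (m := n) (isHomogeneous_monomial a rfl)]
    simp only [eq_comm]
  | add p q hp hq => simp [hp, hq]

theorem isHomogeneous_of_dvd [IsDomain k] {p q : MvPolynomial σ k} {n : ℕ}
    (hq : q.IsHomogeneous n) (h0 : q ≠ 0) (hpq : p ∣ q) : ∃ a, p.IsHomogeneous a := by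
  obtain ⟨r, rfl⟩ := hpq
  have hinj : ∀ p : MvPolynomial σ k, p ≠ 0 → gradingHom σ k p ≠ 0 := fun p hp h => hp <| by
    ext s
    have := congrArg (coeff s) (coeff_gradingHom p s.degree)
    simpa [h, coeff_homogeneousComponent] using this.symm
  have hp := hinj p (left_ne_zero_of_mul h0)
  have hr := hinj r (right_ne_zero_of_mul h0)
  -- The product of the two images is a monomial in t. Top and lowest t-degrees are both additive,
  -- so they must agree in each factor.
  have hm : gradingHom σ k p * gradingHom σ k r = Polynomial.monomial n (p * r) := by
    ext1 m
    rw [← map_mul, coeff_gradingHom, Polynomial.coeff_monomial,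
      homogeneousComponent_of_mem (m := m) hq]
    simp only [eq_comm]
  have hcoeff := coeff_gradingHom p
  generalize gradingHom σ k p = P at hp hm hcoeff
  generalize gradingHom σ k r = Q at hr hm
  have h1 := Polynomial.natDegree_mul hp hr
  have h2 := Polynomial.natTrailingDegree_mul hp hr
  rw [hm, Polynomial.natDegree_monomial_eq _ h0] at h1
  rw [hm, Polynomial.natTrailingDegree_monomial h0] at h2
  have h3 := P.natTrailingDegree_le_natDegree
  have h4 := Q.natTrailingDegree_le_natDegree
  refine ⟨P.natDegree, ?_⟩
  rw [← sum_homogeneousComponent p]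
  refine IsHomogeneous.sum _ _ _ fun i _ => ?_
  by_cases hi : i = P.natDegree
  · exact hi ▸ homogeneousComponent_isHomogeneous _ _
  · rw [← hcoeff]
    rcases lt_or_gt_of_ne hi with hi | hi
    · rw [Polynomial.coeff_eq_zero_of_lt_natTrailingDegree (by omega)]
      exact isHomogeneous_zero _ _ _
    · rw [Polynomial.coeff_eq_zero_of_natDegree_lt hi]
      exact isHomogeneous_zero _ _ _

end Homogeneous

/-! ### Powers dividing the Jacobian minors -/

section Jacobian

/-- A `3 × 3` determinant whose rows are `p i • U + g ^ n • v i`, with the `v i` proportional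
to each other modulo `g`. -/
theorem pow_dvd_det_of_rows_eq {A : Type*} [CommRing A] (g : A) (n : ℕ) (p s U G : Fin 3 → A)
    (b : Fin 3 → Fin 3 → A) :
    g ^ (2 * n + 1) ∣ (Matrix.of fun i j => p i * U j + g ^ n * (s i * G j + g * b i j)).det := by
  -- `g * c` is a 2 × 2 minor of `s i * G j + g * b i j`: the part free of `g` vanishes by rank one.
  -- Expanding by rows, at most one row can come from `U`.
  let c (i i' j j' : Fin 3) : A :=
    s i * G j * b i' j' + s i' * b i j * G j' + g * b i j * b i' j'
      - (s i * G j' * b i' j + s i' * b i j' * G j + g * b i j' * b i' j)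
  refine ⟨p 0 * (U 0 * c 1 2 1 2 - U 1 * c 1 2 0 2 + U 2 * c 1 2 0 1)
    - p 1 * (U 0 * c 0 2 1 2 - U 1 * c 0 2 0 2 + U 2 * c 0 2 0 1)
    + p 2 * (U 0 * c 0 1 1 2 - U 1 * c 0 1 0 2 + U 2 * c 0 1 0 1)
    + g ^ n * ((s 0 * G 0 + g * b 0 0) * c 1 2 1 2 - (s 0 * G 1 + g * b 0 1) * c 1 2 0 2
      + (s 0 * G 2 + g * b 0 2) * c 1 2 0 1), ?_⟩
  rw [pow_succ, mul_comm 2 n, pow_mul, Matrix.det_fin_three]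
  simp only [c, Matrix.of_apply]
  ring

variable {k : Type*} [Field k] {σ : Type*} {ι : Type*}

theorem exists_forall_dvd_sub {f : ι → MvPolynomial σ k} {p : ι → k} (hp : p ≠ 0)
    {D : MvPolynomial σ k} (h : ∀ i j, D ∣ C (p i) * f j - C (p j) * f i) :
    ∃ u, ∀ j, D ∣ f j - C (p j) * u := by
  obtain ⟨i, hi⟩ := Function.ne_iff.1 hp
  refine ⟨C (p i)⁻¹ * f i, fun j => ?_⟩
  have h1 : (C (p i)⁻¹ * C (p i) : MvPolynomial σ k) = 1 := by
    rw [← C_mul, inv_mul_cancel₀ hi, C_1]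
  have := (h i j).mul_left (C (p i)⁻¹)
  rwa [show C (p i)⁻¹ * (C (p i) * f j - C (p j) * f i) = f j - C (p j) * (C (p i)⁻¹ * f i) by
    linear_combination f j * h1] at this

theorem pow_dvd_of_mem_minors_jacobian {m : ℕ} {f : Fin m → MvPolynomial (Fin 3) k}
    {p : Fin m → k} (hp : p ≠ 0) {g : MvPolynomial (Fin 3) k} {e : ℕ} (he : 0 < e)
    (h : ∀ i j, g ^ e ∣ C (p i) * f j - C (p j) * f i)
    {x : MvPolynomial (Fin 3) k} (hx : x ∈ minors 3 (jacobian f)) : g ^ (2 * e - 1) ∣ x := by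
  obtain ⟨n, rfl⟩ := Nat.exists_eq_add_of_lt he
  obtain ⟨u, hu⟩ := exists_forall_dvd_sub hp h
  choose a ha using hu
  obtain ⟨r, c, rfl⟩ := hx
  convert pow_dvd_det_of_rows_eq g n (fun i => C (p (r i))) (fun i => (n + 1) * a (r i))
    (fun j => pderiv (c j) u) (fun j => pderiv (c j) g) (fun i j => pderiv (c j) (a (r i))) using 2
  · omega
  · ext1 i j
    have hf : f (r i) = C (p (r i)) * u + g ^ (n + 1) * a (r i) := by
      linear_combination (by simpa using ha (r i) : f (r i) - C (p (r i)) * u = g ^ (n + 1) * a (r i))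
    simp only [jacobian, Matrix.submatrix_apply, Matrix.of_apply]
    rw [hf, map_add, pderiv_C_mul, Derivation.leibniz, Derivation.leibniz_pow]
    simp only [smul_eq_mul, nsmul_eq_mul, add_tsub_cancel_right]
    push_cast
    ring

end Jacobian

/-! ### The fiber ideal and the minors of (p, f) -/

section Fiber

variable {k : Type*} [Field k] {m n : ℕ} {f : Fin n → MvPolynomial (Fin m) k} {p : Fin n → k}

theorem mem_fiberIdeal_iff {x : MvPolynomial (Fin m) k} :
    x ∈ fiberIdeal f p ↔ ∃ P ∈ reesIdeal f, eval (fun i => C (p i)) P = x :=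
  Ideal.mem_map_iff_of_surjective _ fun x => ⟨C x, eval_C x⟩

theorem mem_reesIdeal_iff {P : MvPolynomial (Fin n) (MvPolynomial (Fin m) k)} :
    P ∈ reesIdeal f ↔
      eval₂ Polynomial.C (fun i => Polynomial.C (f i) * Polynomial.X) P = 0 := by
  rw [reesIdeal, RingHom.mem_ker, ← Subtype.val_inj]
  have : ((reesMap f P : reesAlgebra (baseIdeal f)) : Polynomial (MvPolynomial (Fin m) k))
      = aeval (fun i => Polynomial.monomial 1 (f i)) P := by
    rw [← Subalgebra.coe_val, reesMap, ← AlgHom.comp_apply, comp_aeval]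
    rfl
  rw [this, aeval_def]
  simp only [Polynomial.C_mul_X_eq_monomial]
  rfl

theorem C_mul_sub_C_mul_mem_fiberIdeal (i j : Fin n) :
    C (p i) * f j - C (p j) * f i ∈ fiberIdeal f p := by
  refine mem_fiberIdeal_iff.2 ⟨X i * C (f j) - X j * C (f i), mem_reesIdeal_iff.2 ?_, by simp⟩
  simp only [eval₂_sub, eval₂_mul, eval₂_X, eval₂_C]
  ring

theorem dvd_of_mem_fiberIdeal (hp : p ≠ 0) {D : MvPolynomial (Fin m) k} (hD : D ≠ 0)
    (hf : ∀ g, Prime g → ¬ ∀ i, g ∣ f i)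
    (h : ∀ i j, D ∣ C (p i) * f j - C (p j) * f i) {x : MvPolynomial (Fin m) k}
    (hx : x ∈ fiberIdeal f p) : D ∣ x := by
  obtain ⟨u, hu⟩ := exists_forall_dvd_sub hp h
  have hrel : IsRelPrime D u := by
    rw [UniqueFactorizationMonoid.isRelPrime_iff_no_prime_factors hD]
    refine fun g hgD hgu hg => hf g hg fun i => ?_
    simpa using dvd_add (hgD.trans (hu i)) (hgu.mul_left (C (p i)))
  obtain ⟨P, hP, rfl⟩ := mem_fiberIdeal_iff.1 hx
  rw [mem_reesIdeal_iff] at hP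
  let q := Ideal.Quotient.mk (Ideal.span {D})
  have hq : ∀ a, q a = 0 ↔ D ∣ a := fun a => by
    rw [Ideal.Quotient.eq_zero_iff_mem, Ideal.mem_span_singleton]
  have hfu : ∀ i, q (f i) = q (C (p i)) * q u := fun i => by
    rw [← map_mul, ← sub_eq_zero, ← map_sub, hq]
    exact hu i
  -- `Q` is P(X, p * t) modulo `D`. Replacing t by u * t turns it into P(X, f * t), which is 0; so
  -- each coefficient of `Q` is killed by a power of u and hence vanishes. Setting t = 1 then gives
  -- the claim.
  let Q := eval₂ (Polynomial.C.comp q) (fun i => Polynomial.C (q (C (p i))) * Polynomial.X) P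
  have hQu : Q.comp (Polynomial.C (q u) * Polynomial.X) = 0 := by
    have h1 := hom_eval₂ (S₂ := Polynomial (MvPolynomial (Fin m) k ⧸ Ideal.span {D})) P
      Polynomial.C (Polynomial.mapRingHom q) fun i => Polynomial.C (f i) * Polynomial.X
    rw [hP, map_zero] at h1
    rw [← Polynomial.coe_compRingHom_apply, hom_eval₂]
    convert h1.symm using 2
    · ext <;> simp
    · ext1 i
      simp [hfu, mul_assoc]
  have hQ : Q = 0 := by
    ext l
    have h1 := congrArg (fun R => Polynomial.coeff R l) hQu
    simp only [Polynomial.comp_C_mul_X_coeff, Polynomial.coeff_zero] at h1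
    obtain ⟨a, ha⟩ := Ideal.Quotient.mk_surjective (Q.coeff l)
    change q a = _ at ha
    rw [← ha, ← map_pow, ← map_mul, hq] at h1
    rw [← ha, Polynomial.coeff_zero, hq]
    exact hrel.pow_right.dvd_of_dvd_mul_right h1
  rw [← hq]
  have h1 := congrArg (Polynomial.eval 1) hQ
  rw [← Polynomial.coe_evalRingHom, hom_eval₂, map_zero] at h1
  rw [← h1, eval, coe_eval₂Hom, hom_eval₂]
  congr 1
  · ext <;> simp
  · ext1 i
    simp

theorem isGCDOf_fiberIdeal (hp : p ≠ 0) (hf : ∀ g, Prime g → ¬ ∀ i, g ∣ f i)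
    {h : MvPolynomial (Fin m) k} (h0 : h ≠ 0)
    (hh : IsGCDOf h (Set.range fun ij : Fin n × Fin n => C (p ij.1) * f ij.2 - C (p ij.2) * f ij.1)) :
    IsGCDOf h (fiberIdeal f p : Set (MvPolynomial (Fin m) k)) := by
  refine ⟨fun x hx => dvd_of_mem_fiberIdeal hp h0 hf (fun i j => hh.1 _ ⟨(i, j), rfl⟩) hx,
    fun G hG => hh.2 G ?_⟩
  rintro _ ⟨ij, rfl⟩
  exact hG _ (C_mul_sub_C_mul_mem_fiberIdeal _ _)

theorem exists_C_mul_sub_C_mul_ne_zero [Nontrivial (Fin n)] (hp : p ≠ 0)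
    (hmin : ∀ i, f i ∉ Ideal.span (f '' {i}ᶜ)) :
    ∃ i j, C (p i) * f j - C (p j) * f i ≠ 0 := by
  by_contra! h
  obtain ⟨i, hi⟩ := Function.ne_iff.1 hp
  obtain ⟨j, hj⟩ := exists_ne i
  apply hmin j
  have h1 : (C (p i)⁻¹ * C (p i) : MvPolynomial (Fin m) k) = 1 := by
    rw [← C_mul, inv_mul_cancel₀ hi, C_1]
  rw [show f j = (C (p i)⁻¹ * C (p j)) * f i by
    linear_combination C (p i)⁻¹ * h i j - f j * h1]
  exact Ideal.mul_mem_left _ _ (Ideal.subset_span ⟨i, hj.symm, rfl⟩)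

/-- A prime that divides the `2 × 2` minors of `(p, f)` and of `(p', f)` divides all `f i`, unless
`p` and `p'` are proportional. -/
theorem mk_eq_mk_of_prime_dvd {p' : Fin n → k} (hp : p ≠ 0) (hp' : p' ≠ 0)
    (hf : ∀ g, Prime g → ¬ ∀ i, g ∣ f i) {g : MvPolynomial (Fin m) k} (hg : Prime g)
    (h : ∀ i j, g ∣ C (p i) * f j - C (p j) * f i)
    (h' : ∀ i j, g ∣ C (p' i) * f j - C (p' j) * f i) :
    Projectivization.mk k p hp = Projectivization.mk k p' hp' := by
  obtain ⟨u, hu⟩ := exists_forall_dvd_sub hp h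
  obtain ⟨u', hu'⟩ := exists_forall_dvd_sub hp' h'
  have key : ∀ i j, p i * p' j = p j * p' i := by
    intro i j
    by_contra hne
    -- Modulo `g`, both p * u and p' * u' equal f, so this is f i * f j - f j * f i = 0.
    have h1 : g ∣ C (p i * p' j - p j * p' i) * (u * u') := by
      obtain ⟨a, ha⟩ := hu i
      obtain ⟨b, hb⟩ := hu j
      obtain ⟨a', ha'⟩ := hu' i
      obtain ⟨b', hb'⟩ := hu' j
      refine ⟨b * f i - a * f j + a' * (f j - g * b) - b' * (f i - g * a), ?_⟩
      simp only [C_sub, C_mul]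
      linear_combination C (p j) * u * ha' - C (p i) * u * hb' + (f i - g * a') * hb
        - (f j - g * b') * ha
    have h2 : IsUnit (C (p i * p' j - p j * p' i) : MvPolynomial (Fin m) k) :=
      (isUnit_iff_ne_zero.2 (sub_ne_zero.2 hne)).map C
    rcases hg.dvd_or_dvd (h2.dvd_mul_left.1 h1) with h3 | h3
    · exact hf g hg fun l => by simpa using dvd_add (hu l) (h3.mul_left (C (p l)))
    · exact hf g hg fun l => by simpa using dvd_add (hu' l) (h3.mul_left (C (p' l)))
  obtain ⟨j, hj⟩ := Function.ne_iff.1 hp'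
  rw [Projectivization.mk_eq_mk_iff']
  refine ⟨p j / p' j, funext fun i => ?_⟩
  have hj' : p' j ≠ 0 := hj
  simp only [Pi.smul_apply, smul_eq_mul]
  field_simp
  linear_combination -key i j

end Fiber

attribute [local instance] MvPolynomial.gradedAlgebra

/-! ### One-dimensional fibers contain a curve -/

section Dimension

section
variable {A S : Type*} [CommRing A] [SetLike S A] [AddSubgroupClass S A] {𝒜 : ℕ → S}
  [GradedRing 𝒜]

theorem isPrime_vanishingIdeal {Z : Set (ProjectiveSpectrum 𝒜)} (hZ : IsIrreducible Z) :
    (ProjectiveSpectrum.vanishingIdeal Z).toIdeal.IsPrime := by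
  constructor
  · obtain ⟨x, hx⟩ := hZ.nonempty
    rw [Ideal.ne_top_iff_one]
    intro h
    exact (Ideal.ne_top_iff_one _).1 x.isPrime.ne_top
      ((ProjectiveSpectrum.mem_vanishingIdeal _ _).1 h x hx)
  · intro a b hab
    by_contra! hn
    simp only [HomogeneousIdeal.mem_iff, ProjectiveSpectrum.mem_vanishingIdeal, not_forall] at hn hab
    obtain ⟨⟨x, hx, hax⟩, y, hy, hby⟩ := hn
    obtain ⟨z, hz, haz, hbz⟩ := hZ.2 (ProjectiveSpectrum.basicOpen 𝒜 a)
      (ProjectiveSpectrum.basicOpen 𝒜 b) (ProjectiveSpectrum.isOpen_basicOpen 𝒜)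
      (ProjectiveSpectrum.isOpen_basicOpen 𝒜) ⟨x, hx, hax⟩ ⟨y, hy, hby⟩
    exact (z.isPrime.mem_or_mem (hab z hz)).elim haz hbz

end

variable {k : Type*} [Field k] {σ : Type*}

theorem toIdeal_irrelevant_homogeneousSubmodule :
    (HomogeneousIdeal.irrelevant (homogeneousSubmodule σ k)).toIdeal
      = RingHom.ker (constantCoeff : MvPolynomial σ k →+* k) := by
  ext a
  rw [HomogeneousIdeal.mem_iff, HomogeneousIdeal.mem_irrelevant_iff, RingHom.mem_ker]
  have : GradedRing.proj (homogeneousSubmodule σ k) 0 a = C (constantCoeff a) := by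
    rw [constantCoeff_eq, ← homogeneousComponent_zero]
    exact decomposition.decompose'_apply a 0
  rw [this, C_eq_zero]

theorem le_irrelevant_of_ne_top {I : HomogeneousIdeal (homogeneousSubmodule σ k)}
    (hI : I.toIdeal ≠ ⊤) : I ≤ HomogeneousIdeal.irrelevant (homogeneousSubmodule σ k) := by
  change I.toIdeal ≤ (HomogeneousIdeal.irrelevant (homogeneousSubmodule σ k)).toIdeal
  intro a ha
  rw [toIdeal_irrelevant_homogeneousSubmodule, RingHom.mem_ker]
  by_contra h0
  have h1 : homogeneousComponent 0 a ∈ I.toIdeal :=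
    (mem_iff_homogeneousComponent_mem I.isHomogeneous a).1 ha 0
  rw [homogeneousComponent_zero] at h1
  exact hI (Ideal.eq_top_of_isUnit_mem _ h1 ((isUnit_iff_ne_zero.2 h0).map C))

theorem irrelevant_isPrime :
    (HomogeneousIdeal.irrelevant (homogeneousSubmodule σ k)).toIdeal.IsPrime := by
  rw [toIdeal_irrelevant_homogeneousSubmodule]
  exact RingHom.ker_isPrime _

theorem vanishingIdeal_lt_irrelevant {Z : Set (ProjectiveSpectrum (homogeneousSubmodule σ k))}
    (hZ : Z.Nonempty) : ProjectiveSpectrum.vanishingIdeal Z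
      < HomogeneousIdeal.irrelevant (homogeneousSubmodule σ k) := by
  obtain ⟨x, hx⟩ := hZ
  have hle : ProjectiveSpectrum.vanishingIdeal Z ≤ x.asHomogeneousIdeal := fun a ha =>
    (ProjectiveSpectrum.mem_vanishingIdeal _ _).1 ha x hx
  refine lt_of_le_not_ge (le_irrelevant_of_ne_top fun h => ?_)
    fun h => x.not_irrelevant_le (h.trans hle)
  exact x.isPrime.ne_top (top_le_iff.1 (h ▸ hle))

/-- A chain of two irreducible closed sets Z ⊂ W in the zero locus gives primes I(W) < I(Z) <
irrelevant ideal. The last has height at most 3, so I(W) has height at most 1 and is principal; it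
contains J. -/
theorem exists_prime_dvd_of_one_le_topologicalKrullDim {J : Ideal (MvPolynomial (Fin 3) k)}
    (hJ : J ≠ ⊥) (hdim : 1 ≤ topologicalKrullDim
      (ProjectiveSpectrum.zeroLocus (homogeneousSubmodule (Fin 3) k) (J : Set _))) :
    ∃ g, Prime g ∧ ∀ x ∈ J, g ∣ x := by
  set Y := ProjectiveSpectrum.zeroLocus (homogeneousSubmodule (Fin 3) k)
    (J : Set (MvPolynomial (Fin 3) k)) with hY
  obtain ⟨s, hs⟩ := Order.le_krullDim_iff.1 (show ((1 : ℕ) : WithBot ℕ∞) ≤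
    Order.krullDim (TopologicalSpace.IrreducibleCloseds Y) from hdim)
  have hlt : s 0 < s 1 := s.strictMono (by simp [Fin.lt_def, hs])
  have hlt' := TopologicalSpace.IrreducibleCloseds.map_strictMono_of_isInducing
    (Topology.IsInducing.subtypeVal (t := Y)) hlt
  set Z := TopologicalSpace.IrreducibleCloseds.map _ continuous_subtype_val (s 0)
  set W := TopologicalSpace.IrreducibleCloseds.map _ continuous_subtype_val (s 1)
  have hZW : (Z : Set (ProjectiveSpectrum (homogeneousSubmodule (Fin 3) k))) ⊂ W := ⟨hlt'.le, hlt'.not_ge⟩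
  have hWY : (W : Set (ProjectiveSpectrum (homogeneousSubmodule (Fin 3) k))) ⊆ Y := by
    refine closure_minimal ?_ (ProjectiveSpectrum.isClosed_zeroLocus _ _)
    rintro _ ⟨x, -, rfl⟩
    exact x.2
  have hvlt : (ProjectiveSpectrum.vanishingIdeal (W : Set (ProjectiveSpectrum (homogeneousSubmodule (Fin 3) k)))).toIdeal
      < (ProjectiveSpectrum.vanishingIdeal (Z : Set (ProjectiveSpectrum (homogeneousSubmodule (Fin 3) k)))).toIdeal := by
    refine lt_of_le_not_ge
      (ProjectiveSpectrum.vanishingIdeal_anti_mono _ hZW.1) fun hge => hZW.2 ?_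
    rw [← Z.isClosed.closure_eq, ← ProjectiveSpectrum.zeroLocus_vanishingIdeal_eq_closure,
      ProjectiveSpectrum.subset_zeroLocus_iff_subset_vanishingIdeal]
    exact hge
  have hJW : J ≤ (ProjectiveSpectrum.vanishingIdeal (W : Set (ProjectiveSpectrum (homogeneousSubmodule (Fin 3) k)))).toIdeal :=
    (ProjectiveSpectrum.subset_zeroLocus_iff_le_vanishingIdeal _ _).1 hWY
  have hm := irrelevant_isPrime (σ := Fin 3) (k := k)
  have hvm : (ProjectiveSpectrum.vanishingIdeal (Z : Set (ProjectiveSpectrum (homogeneousSubmodule (Fin 3) k)))).toIdeal <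
      (HomogeneousIdeal.irrelevant (homogeneousSubmodule (Fin 3) k)).toIdeal :=
    vanishingIdeal_lt_irrelevant Z.isIrreducible.nonempty
  have hpW := isPrime_vanishingIdeal W.isIrreducible
  have hpZ := isPrime_vanishingIdeal Z.isIrreducible
  obtain ⟨g, hgq, hg⟩ := hpW.exists_mem_prime_of_ne_bot fun h => hJ (by rwa [h, le_bot_iff] at hJW)
  have hm3 := Ideal.height_le_ringKrullDim_of_isPrime
    (I := (HomogeneousIdeal.irrelevant (homogeneousSubmodule (Fin 3) k)).toIdeal)
  rw [ringKrullDim_of_isNoetherianRing, ringKrullDim_eq_zero_of_field] at hm3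
  have hm3' : (HomogeneousIdeal.irrelevant (homogeneousSubmodule (Fin 3) k)).toIdeal.height
      ≤ 3 := by
    simp only [Nat.card_eq_fintype_card, Fintype.card_fin, zero_add] at hm3
    exact WithBot.coe_le_coe.1 hm3
  have h1 := Ideal.height_add_one_le_of_lt_of_isPrime hvlt
  have h2 := Ideal.height_add_one_le_of_lt_of_isPrime hvm
  have hW1 : (ProjectiveSpectrum.vanishingIdeal (W : Set (ProjectiveSpectrum (homogeneousSubmodule (Fin 3) k)))).toIdeal.height
      ≤ 1 := by
    refine (ENat.add_le_add_iff_right (show (2 : ℕ∞) ≠ ⊤ by decide)).1 ?_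
    calc _ = _ + 1 + 1 := by rw [add_assoc, one_add_one_eq_two]
      _ ≤ _ := (add_le_add_left h1 1).trans (h2.trans hm3')
  have := eq_span_singleton_of_prime_mem_of_height_le_one hW1 hg hgq
  exact ⟨g, hg, fun x hx => Ideal.mem_span_singleton.1 (this ▸ hJW hx)⟩

end Dimension

/-! ### Degree computations -/

section Degree

theorem totalDegree_prod_pow {σ k ι : Type*} [Field k] (s : Finset ι)
    (g : ι → MvPolynomial σ k) (e : ι → ℕ) (hg : ∀ i ∈ s, g i ≠ 0) :
    (∏ i ∈ s, g i ^ e i).totalDegree = ∑ i ∈ s, e i * (g i).totalDegree := by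
  classical
  have hpow : ∀ (p : MvPolynomial σ k) (n : ℕ), p ≠ 0 →
      (p ^ n).totalDegree = n * p.totalDegree := by
    intro p n hp
    induction n with
    | zero => simp
    | succ n ih =>
      rw [pow_succ, totalDegree_mul_of_isDomain (pow_ne_zero n hp) hp, ih]
      ring
  induction s using Finset.induction_on with
  | empty => simp
  | insert i s hi ih =>
    have hs : ∀ j ∈ s, g j ≠ 0 := fun j hj => hg j (Finset.mem_insert_of_mem hj)
    have hgi := hg i (Finset.mem_insert_self i s)
    rw [Finset.prod_insert hi, Finset.sum_insert hi, totalDegree_mul_of_isDomain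
      (pow_ne_zero _ hgi) (Finset.prod_ne_zero_iff.2 fun j hj => pow_ne_zero _ (hs j hj)),
      ih hs, hpow _ _ hgi]

theorem totalDegree_le_of_mem_minors_jacobian {k : Type*} [Field k] {m n s d : ℕ}
    {f : Fin n → MvPolynomial (Fin m) k} (hdeg : ∀ i, (f i).IsHomogeneous d)
    {x : MvPolynomial (Fin m) k} (hx : x ∈ minors s (jacobian f)) :
    x.totalDegree ≤ s * (d - 1) := by
  obtain ⟨r, c, rfl⟩ := hx
  apply IsHomogeneous.totalDegree_le
  rw [Matrix.det_apply']
  refine IsHomogeneous.sum _ _ _ fun π _ => ?_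
  have h1 : (∏ i, (jacobian f).submatrix r c (π i) i).IsHomogeneous (s * (d - 1)) := by
    convert IsHomogeneous.prod Finset.univ _ (fun _ => d - 1)
      (fun i _ => (hdeg (r (π i))).pderiv (i := c i)) using 1 <;> simp [jacobian]
  have h2 := h1.C_mul (((Equiv.Perm.sign π : ℤˣ) : ℤ) : k)
  simpa using h2

end Degree

end ProjectiveRationalMap

/-! ### Assembly of the theorem -/

theorem corollary3p1 {k : Type*} [Field k] [IsAlgClosed k] (d : ℕ)
    (f : Fin 4 → MvPolynomial (Fin 3) k)
    (hdeg : ∀ i, (f i).IsHomogeneous d)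
    (hmin : ∀ i, f i ∉ Ideal.span (f '' {i}ᶜ))
    (hcodim : (baseIdeal f).height = 2)
    (hjac : minorsIdeal 3 (jacobian f) ≠ ⊥)
    (F : MvPolynomial (Fin 3) k) (hF : IsGCDOf F (minors 3 (jacobian f))) :
    ∃ hfin : (pointsWithFiberDim f 1).Finite,
      (∀ y ∈ pointsWithFiberDim f 1, ∃ h, IsUnmixedFiberEquation f y h) ∧
      (∀ (h : ℙ k (Fin 4 → k) → MvPolynomial (Fin 3) k) (r : ℙ k (Fin 4 → k) → ℕ)
          (g : ∀ y, Fin (r y) → MvPolynomial (Fin 3) k) (e : ∀ y, Fin (r y) → ℕ),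
        (∀ y ∈ pointsWithFiberDim f 1, IsUnmixedFiberEquation f y (h y) ∧
          IsIrreducibleFactorization (h y) (g y) (e y)) →
        ∑ y ∈ hfin.toFinset, (h y).totalDegree ≤
            ∑ y ∈ hfin.toFinset, ∑ i, (2 * e y i - 1) * (g y i).totalDegree ∧
          ∑ y ∈ hfin.toFinset, ∑ i, (2 * e y i - 1) * (g y i).totalDegree ≤ F.totalDegree) ∧
      F.totalDegree ≤ 3 * (d - 1) := by
  have hprime : ∀ g, Prime g → ¬ ∀ i, g ∣ f i := fun g hg =>
    not_forall_prime_dvd_of_one_lt_height_span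
      (by change 1 < (baseIdeal f).height; rw [hcodim]; exact Nat.one_lt_ofNat) hg
  obtain ⟨x, hx, hx0⟩ : ∃ x ∈ minors 3 (jacobian f), x ≠ 0 := by
    by_contra! h
    exact hjac (Ideal.span_eq_bot.2 h)
  have hFx : F ∣ x := hF.1 x hx
  have hF0 : F ≠ 0 := ne_zero_of_dvd_ne_zero hx0 hFx
  choose H hH using fun y : ℙ k (Fin 4 → k) => exists_isGCDOf_range
    fun ij : Fin 4 × Fin 4 =>
      MvPolynomial.C (y.rep ij.1) * f ij.2 - MvPolynomial.C (y.rep ij.2) * f ij.1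
  have hHdvd : ∀ y i j, H y ∣
      MvPolynomial.C (y.rep i) * f j - MvPolynomial.C (y.rep j) * f i :=
    fun y i j => (hH y).1 _ ⟨(i, j), rfl⟩
  have hne := fun y : ℙ k (Fin 4 → k) => exists_C_mul_sub_C_mul_ne_zero y.rep_nonzero hmin
  have hH0 : ∀ y, H y ≠ 0 := fun y => by
    obtain ⟨i, j, hij⟩ := hne y
    exact ne_zero_of_dvd_ne_zero hij (hHdvd y i j)
  have hHJ := fun y => isGCDOf_fiberIdeal y.rep_nonzero hprime (hH0 y) (hH y)
  have hJ : ∀ y : ℙ k (Fin 4 → k), fiberIdeal f y.rep ≠ ⊥ := fun y hbot => by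
    obtain ⟨i, j, hij⟩ := hne y
    exact hij (by simpa [hbot] using C_mul_sub_C_mul_mem_fiberIdeal (f := f) (p := y.rep) i j)
  have hfactor : ∀ y ∈ pointsWithFiberDim f 1, ∃ g, Prime g ∧ g ∣ H y := by
    intro y hy
    obtain ⟨g, hg, hgJ⟩ :=
      exists_prime_dvd_of_one_le_topologicalKrullDim (hJ y) (le_of_eq (Eq.symm hy))
    exact ⟨g, hg, (hHJ y).2 g hgJ⟩
  have hunmixed : ∀ y ∈ pointsWithFiberDim f 1,
      unmixedPart (fiberIdeal f y.rep) = Ideal.span {H y} := by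
    intro y hy
    obtain ⟨g, hg, hgH⟩ := hfactor y hy
    exact unmixedPart_eq_span_of_isGCDOf (hJ y) (hHJ y) fun hu =>
      hg.not_isUnit (isUnit_of_dvd_unit hgH hu)
  have hpow : ∀ y g e, 0 < e → g ^ e ∣ H y → g ^ (2 * e - 1) ∣ F := fun y g e he hg =>
    hF.2 _ fun z hz => pow_dvd_of_mem_minors_jacobian y.rep_nonzero he
      (fun i j => hg.trans (hHdvd y i j)) hz
  have hinj : ∀ y y' g, Prime g → g ∣ H y → g ∣ H y' → y = y' := fun y y' g hg hy hy' => by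
    rw [← y.mk_rep, ← y'.mk_rep]
    exact mk_eq_mk_of_prime_dvd y.rep_nonzero y'.rep_nonzero hprime hg
      (fun i j => hy.trans (hHdvd y i j)) (fun i j => hy'.trans (hHdvd y' i j))
  have hfin : (pointsWithFiberDim f 1).Finite := by
    classical
    have : ∀ y ∈ pointsWithFiberDim f 1,
        ∃ q ∈ UniqueFactorizationMonoid.factors F, q ∣ H y := by
      intro y hy
      obtain ⟨g, hg, hgH⟩ := hfactor y hy
      -- With exponent e = 1, 2 * e - 1 is again 1.
      have hgF : g ∣ F := by simpa using hpow y g 1 one_pos (by simpa using hgH)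
      obtain ⟨q, hq, hgq⟩ :=
        UniqueFactorizationMonoid.exists_mem_factors_of_dvd hF0 hg.irreducible hgF
      exact ⟨q, hq, hgq.symm.dvd.trans hgH⟩
    choose! q hq hqH using this
    refine Set.Finite.of_injOn (f := q)
      (t := ((UniqueFactorizationMonoid.factors F).toFinset : Set _))
      (fun y hy => by simpa using hq y hy) (fun y hy y' hy' hyy' => ?_) (Finset.finite_toSet _)
    exact hinj y y' (q y) (UniqueFactorizationMonoid.prime_of_factor _ (hq y hy)) (hqH y hy)
      (hyy' ▸ hqH y' hy')
  refine ⟨hfin, fun y hy => ⟨H y, ?_, (hunmixed y hy).symm⟩, fun h r g e hfact => ⟨?_, ?_⟩,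
    (MvPolynomial.totalDegree_le_of_dvd_of_isDomain hFx hx0).trans
      (totalDegree_le_of_mem_minors_jacobian hdeg hx)⟩
  · obtain ⟨i, j, hij⟩ := hne y
    exact isHomogeneous_of_dvd (((hdeg j).C_mul _).sub ((hdeg i).C_mul _)) hij (hHdvd y i j)
  · refine Finset.sum_le_sum fun y hy => ?_
    obtain ⟨-, hg⟩ := hfact y (hfin.mem_toFinset.1 hy)
    have hg0 : ∀ i ∈ Finset.univ, g y i ≠ 0 := fun i _ => (hg.irreducible i).ne_zero
    refine (MvPolynomial.totalDegree_le_of_dvd_of_isDomain hg.factorization.dvd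
      (Finset.prod_ne_zero_iff.2 fun i hi => pow_ne_zero _ (hg0 i hi))).trans ?_
    rw [totalDegree_prod_pow _ _ _ hg0]
    refine Finset.sum_le_sum fun i _ => Nat.mul_le_mul_right _ ?_
    have := hg.exponent_pos i
    omega
  · have hgH : ∀ y ∈ pointsWithFiberDim f 1, ∀ i, g y i ^ e y i ∣ H y := by
      intro y hy i
      obtain ⟨⟨-, hspan⟩, hg⟩ := hfact y hy
      rw [hunmixed y hy, Ideal.span_singleton_eq_span_singleton] at hspan
      exact (Finset.dvd_prod_of_mem (fun i => g y i ^ e y i) (Finset.mem_univ i)).trans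
        (hg.factorization.symm.trans hspan).dvd
    have hgH' : ∀ y ∈ pointsWithFiberDim f 1, ∀ i, g y i ∣ H y := fun y hy i =>
      (dvd_pow_self _ ((hfact y hy).2.exponent_pos i).ne').trans (hgH y hy i)
    rw [Finset.sum_sigma', ← totalDegree_prod_pow _ (fun a : Σ y, Fin (r y) => g a.1 a.2)
      (fun a => 2 * e a.1 a.2 - 1)]
    -- Coprimality holds across different points by `hinj`, and at a single point because its
    -- factors are non-associated.
    · refine MvPolynomial.totalDegree_le_of_dvd_of_isDomain
        (Finset.prod_dvd_of_isRelPrime ?_ ?_) hF0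
      · rintro ⟨y, i⟩ hy ⟨y', j⟩ hy' hne'
        simp only [Finset.coe_sigma, Set.mem_sigma_iff, Finset.mem_coe, hfin.mem_toFinset] at hy hy'
        refine IsRelPrime.pow (((hfact y hy.1).2.irreducible i).isRelPrime_iff_not_dvd.2 ?_)
        intro hdvd
        have hirr := (hfact y hy.1).2.irreducible i
        obtain rfl := hinj y y' _ hirr.prime (hgH' y hy.1 i) (hdvd.trans (hgH' y' hy'.1 j))
        refine (hfact y hy.1).2.not_associated i j (fun hij => hne' (by rw [hij])) ?_
        exact hirr.associated_of_dvd ((hfact y hy.1).2.irreducible j) hdvd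
      · rintro ⟨y, i⟩ hy
        have hy' := hfin.mem_toFinset.1 (Finset.mem_sigma.1 hy).1
        exact hpow y _ _ ((hfact y hy').2.exponent_pos i) (hgH y hy' i)
    · rintro ⟨y, i⟩ hy
      exact ((hfact y (hfin.mem_toFinset.1 (Finset.mem_sigma.1 hy).1)).2.irreducible i).ne_zero
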